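/- A \emph{timed word} over a finite alphabet $\Sigma$ is a non-empty finite sequence $(a_1,t_1)\dots(a_n,t_n)$ in $\Sigma\times\mathbb{R}_{\ge 0}$ with $t_1\le\dots\le t_n$. \emph{MTL formulae} over $\Sigma$ are given by $\varphi::=\mathtt{true}\mid a\mid\neg\varphi\mid\varphi_1\wedge\varphi_2\mid\varphi_1\mathsf{U}_I\varphi_2$, where $a\in\Sigma$ and $I\subseteq\mathbb{R}_{\ge0}$ is an open, closed or half-open interval with endpoints in $\mathbb{N}\cup\{\infty\}$. They are interpreted in the pointwise semantics: for $w=(a_1,t_1)\dots(a_n,t_n)$, $(w,i)\models a$ iff $a_i=a$; Boolean connectives are as usual; $(w,i)\models\varphi_1\mathsf{U}_I\varphi_2$ iff there is $j$ with $i<j\le n$, $(w,j)\models\varphi_2$, $t_j-t_i\in I$, and $(w,k)\models\varphi_1$ for all $i<k<j$. We write $w\models\varphi$ if $(w,1)\models\varphi$. A \emph{timed automaton with discrete weights} (dWTA) consists of a finite alphabet $\Sigma$, finite sets $\mathcal{L}$ of locations, $\mathcal{L}_0,\mathcal{L}_f\subseteq\mathcal{L}$ of initial and accepting locations, and $\mathcal{X}$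 of clocks, and a finite set of edges $(l,a,\phi,\mathsf{op},\lambda,l')$ with $l,l'\in\mathcal{L}$, $a\in\Sigma$, $\phi$ a finite conjunction of constraints $x\sim c$ ($x\in\mathcal{X}$, $c\in\mathbb{N}$, ${\sim}\in\{<,\le,=,\ge,>\}$; the empty conjunction is $\mathtt{true}$), $\mathsf{op}\in\{push,pop,noop\}$ and $\lambda\subseteq\mathcal{X}$. A state is a triple $(l,\nu,z)$ with $l\in\mathcal{L}$, $\nu:\mathcal{X}\to\mathbb{R}_{\ge0}$ and weight $z\in\mathbb{Z}$. There is a transition from $(l,\nu,z)$ to $(l',\nu',z')$ with delay $\delta\in\mathbb{R}_{\ge 0}$ and letter $a$ iff there is an edge $(l,a,\phi,\mathsf{op},\lambda,l')$ such that $\nu+\delta\models\phi$, $\nu'$ is obtained from $\nu+\delta$ by setting the clocks in $\lambda$ to $0$, and $z'-z$ is $1$, $-1$ or $0$ if $\mathsf{op}$ is $push$, $pop$ or $noop$, respectively (transitions to negative weights are allowed). A \emph{run} is a non-empty finite sequence of consecutive transitions; it is \emph{accepting} if it starts in a location of $\mathcal{L}_0$ with all clocks and the weight equal to $0$ and ends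 in a location of $\mathcal{L}_f$. A run with letters $a_1,\dots,a_n$ and delays $\delta_1,\dots,\delta_n$ has the associated timed word $(a_1,\delta_1)(a_2,\delta_1+\delta_2)\dots(a_n,\delta_1+\dots+\delta_n)$. The \emph{model checking energy problem} for dWTA and MTL is: given a dWTA $\mathcal{A}$ over a finite alphabet $\Sigma$ and an MTL formula $\varphi$ over $\Sigma$, is there an accepting run of $\mathcal{A}$ along which the weight is always non-negative and whose associated timed word satisfies $\varphi$? \textbf{Theorem.} The model checking energy problem for dWTA and MTL is undecidable, and it remains undecidable if the dWTA is required to have no clocks ($\mathcal{X}=\emptyset$). -/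

import Mathlib

open scoped NNReal

namespace DWTAEnergy

/-- The comparison symbols `<`, `≤`, `=`, `≥`, `>`. -/
inductive Cmp where
  | lt | le | eq | ge | gt

def Cmp.Holds : Cmp → ℝ≥0 → ℕ → Prop
  | .lt, v, c => v < (c : ℝ≥0)
  | .le, v, c => v ≤ (c : ℝ≥0)
  | .eq, v, c => v = (c : ℝ≥0)
  | .ge, v, c => v ≥ (c : ℝ≥0)
  | .gt, v, c => v > (c : ℝ≥0)

/-- An atomic clock constraint `x ∼ c`. -/
structure ClockAtom (X : Type) where
  clock : X
  cmp : Cmp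
  bound : ℕ

/-- A clock constraint is a finite conjunction of atomic constraints, given by the list of its
conjuncts; the empty list is `true` (the only constraint if there are no clocks). -/
abbrev ClockConstraint (X : Type) := List (ClockAtom X)

/-- Clock valuations. -/
abbrev Valuation (X : Type) := X → ℝ≥0

def ClockConstraint.Sat {X : Type} (g : ClockConstraint X) (v : Valuation X) : Prop :=
  ∀ p ∈ g, p.cmp.Holds (v p.clock) p.bound

/-- The operations of a one-counter net: there is no zero test. -/
inductive CounterOp where
  | push | pop | noop

/-- The change of the weight variable that an operation causes. -/
def CounterOp.effect : CounterOp → ℤ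
  | .push => 1
  | .pop => -1
  | .noop => 0

/-- Edges over the alphabet `S`, the locations `L` and the clocks `X`. The set of clocks to be
reset is given by a list. -/
structure Edge (S L X : Type) where
  source : L
  letter : S
  guard : ClockConstraint X
  op : CounterOp
  reset : List X
  target : L

/-- A timed automaton with discrete weights over the alphabet `S`, with locations `L` and clocks
`X`; its finite sets of initial locations, accepting locations and edges are given by lists. -/
structure DWTA (S L X : Type) where
  initial : List L
  accepting : List L
  edges : List (Edge S L X)

/-- A state: location, clock valuation, and value of the weight variable (possibly negative). -/
structure State (L X : Type) where
  loc : L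
  val : Valuation X
  weight : ℤ

open Classical in
/-- The transition relation. The weight never blocks a transition. -/
def DWTA.Step {S L X : Type} (A : DWTA S L X) (q : State L X) (d : ℝ≥0) (a : S)
    (q' : State L X) : Prop :=
  ∃ e ∈ A.edges, e.source = q.loc ∧ e.letter = a ∧ e.target = q'.loc ∧
    e.guard.Sat (fun x => q.val x + d) ∧
    (∀ x, q'.val x = if x ∈ e.reset then 0 else q.val x + d) ∧
    q'.weight = q.weight + e.op.effect

/-- A (non-empty) run. -/
structure DWTA.Run {S L X : Type} (A : DWTA S L X) where
  len : ℕ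
  len_pos : 0 < len
  state : Fin (len + 1) → State L X
  delay : Fin len → ℝ≥0
  letter : Fin len → S
  step : ∀ i : Fin len, A.Step (state i.castSucc) (delay i) (letter i) (state i.succ)

/-- Accepting (successful) runs: they start in an initial location with all clocks and the weight
equal to zero, and end in an accepting location. -/
def DWTA.Run.Accepting {S L X : Type} {A : DWTA S L X} (r : A.Run) : Prop :=
  (r.state 0).loc ∈ A.initial ∧ (∀ x, (r.state 0).val x = 0) ∧ (r.state 0).weight = 0 ∧
    (r.state (Fin.last r.len)).loc ∈ A.accepting

/-- Non-empty finite timed words with non-decreasing timestamps. -/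
structure TimedWord (S : Type) where
  len : ℕ
  len_pos : 0 < len
  letter : Fin len → S
  time : Fin len → ℝ≥0
  mono : Monotone time

/-- The timed word associated with a run. -/
def DWTA.Run.word {S L X : Type} {A : DWTA S L X} (r : A.Run) : TimedWord S where
  len := r.len
  len_pos := r.len_pos
  letter := r.letter
  time := fun i => ∑ j ∈ Finset.Iic i, r.delay j
  mono := fun _ _ h => Finset.sum_le_sum_of_subset (Finset.Iic_subset_Iic.2 h)

/-- Intervals of non-negative reals with endpoints in `ℕ ∪ {∞}`; `upper = none` is the endpoint
`∞`, and the Booleans tell whether the finite endpoints belong to the interval. -/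
structure TimeInterval where
  lower : ℕ
  lowerClosed : Bool
  upper : Option ℕ
  upperClosed : Bool

def TimeInterval.toSet (I : TimeInterval) : Set ℝ :=
  {x | (if I.lowerClosed then (I.lower : ℝ) ≤ x else (I.lower : ℝ) < x) ∧
    ∀ u ∈ I.upper, if I.upperClosed then x ≤ (u : ℝ) else x < (u : ℝ)}

/-- MTL formulae over the alphabet `S`. -/
inductive MTL (S : Type) where
  | tt : MTL S
  | atom (a : S) : MTL S
  | neg (f : MTL S) : MTL S
  | conj (f g : MTL S) : MTL S
  | til (I : TimeInterval) (f g : MTL S) : MTL S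

/-- The pointwise semantics `(w, i) ⊨ f`, with positions counted from zero and strict until. -/
def MTL.SatAt {S : Type} (w : TimedWord S) : MTL S → Fin w.len → Prop
  | .tt, _ => True
  | .atom a, i => w.letter i = a
  | .neg f, i => ¬ f.SatAt w i
  | .conj f g, i => f.SatAt w i ∧ g.SatAt w i
  | .til I f g, i => ∃ j, i < j ∧ g.SatAt w j ∧ (w.time j : ℝ) - (w.time i : ℝ) ∈ I.toSet ∧
      ∀ k, i < k → k < j → f.SatAt w k

/-- `w ⊨ f`: the formula holds at the first position. -/
def TimedWord.Satisfies {S : Type} (w : TimedWord S) (f : MTL S) : Prop :=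
  f.SatAt w ⟨0, w.len_pos⟩

/-- Some accepting run keeps the weight non-negative, and its timed word satisfies `f`. -/
def EnergyHolds {S L X : Type} (A : DWTA S L X) (f : MTL S) : Prop :=
  ∃ r : A.Run, r.Accepting ∧ (∀ i, 0 ≤ (r.state i).weight) ∧ r.word.Satisfies f

/-- An instance of the problem: alphabet, locations and clocks are arbitrary finite sets, named
by initial segments of the natural numbers. -/
structure Problem where
  numSymbols : ℕ
  numLocs : ℕ
  numClocks : ℕ
  automaton : DWTA (Fin numSymbols) (Fin numLocs) (Fin numClocks)
  formula : MTL (Fin numSymbols)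

def Problem.Positive (P : Problem) : Prop := EnergyHolds P.automaton P.formula

/-! Instances are written down as tuples and lists of natural numbers. -/

def Cmp.code : Cmp → ℕ
  | .lt => 0 | .le => 1 | .eq => 2 | .ge => 3 | .gt => 4

theorem Cmp.code_injective : Function.Injective Cmp.code := by
  intro a b h
  cases a <;> cases b <;> simp [Cmp.code] at h ⊢

def CounterOp.code : CounterOp → ℕ
  | .push => 0 | .pop => 1 | .noop => 2

theorem CounterOp.code_injective : Function.Injective CounterOp.code := by
  intro a b h
  cases a <;> cases b <;> simp [CounterOp.code] at h ⊢

def ClockAtom.code {c : ℕ} (p : ClockAtom (Fin c)) : ℕ × ℕ × ℕ :=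
  (p.clock.val, p.cmp.code, p.bound)

theorem ClockAtom.code_injective {c : ℕ} :
    Function.Injective (ClockAtom.code : ClockAtom (Fin c) → _) := by
  rintro ⟨x, s, b⟩ ⟨x', s', b'⟩ h
  simp only [ClockAtom.code, Prod.mk.injEq] at h
  obtain ⟨h1, h2, h3⟩ := h
  rw [Fin.val_injective h1, Cmp.code_injective h2, h3]

/-- Codes of edges: source, letter, guard, operation, reset, target. -/
abbrev EdgeCode := ℕ × ℕ × List (ℕ × ℕ × ℕ) × ℕ × List ℕ × ℕ

def Edge.code {k m c : ℕ} (e : Edge (Fin k) (Fin m) (Fin c)) : EdgeCode :=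
  (e.source.val, e.letter.val, e.guard.map ClockAtom.code, e.op.code, e.reset.map Fin.val,
    e.target.val)

theorem Edge.code_injective {k m c : ℕ} :
    Function.Injective (Edge.code : Edge (Fin k) (Fin m) (Fin c) → _) := by
  rintro ⟨l, a, g, o, r, t⟩ ⟨l', a', g', o', r', t'⟩ h
  simp only [Edge.code, Prod.mk.injEq] at h
  obtain ⟨h1, h2, h3, h4, h5, h6⟩ := h
  rw [Fin.val_injective h1, Fin.val_injective h2,
    List.map_injective_iff.2 ClockAtom.code_injective h3, CounterOp.code_injective h4,
    List.map_injective_iff.2 Fin.val_injective h5, Fin.val_injective h6]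

def TimeInterval.code (I : TimeInterval) : ℕ :=
  Encodable.encode (I.lower, I.lowerClosed, I.upper, I.upperClosed)

theorem TimeInterval.code_injective : Function.Injective TimeInterval.code := by
  rintro ⟨l, b, u, d⟩ ⟨l', b', u', d'⟩ h
  have h' := Encodable.encode_injective h
  simp only [Prod.mk.injEq] at h'
  obtain ⟨rfl, rfl, rfl, rfl⟩ := h'
  rfl

/-- Gödel numbering of formulae: a tag for the outermost operator, paired with its arguments. -/
def MTL.code {k : ℕ} : MTL (Fin k) → ℕ
  | .tt => Nat.pair 0 0
  | .atom a => Nat.pair 1 a.val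
  | .neg f => Nat.pair 2 f.code
  | .conj f g => Nat.pair 3 (Nat.pair f.code g.code)
  | .til I f g => Nat.pair 4 (Nat.pair I.code (Nat.pair f.code g.code))

theorem MTL.code_injective {k : ℕ} : Function.Injective (MTL.code : MTL (Fin k) → ℕ) := by
  intro f
  induction f with
  | tt => intro g h; cases g <;> simp [MTL.code, Nat.pair_eq_pair] at h ⊢
  | atom a =>
    intro g h
    cases g <;> simp [MTL.code, Nat.pair_eq_pair] at h ⊢
    exact Fin.val_injective h
  | neg f ih =>
    intro g h
    cases g <;> simp [MTL.code, Nat.pair_eq_pair] at h ⊢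
    exact ih h
  | conj f f' ih ih' =>
    intro g h
    cases g <;> simp [MTL.code, Nat.pair_eq_pair] at h ⊢
    exact ⟨ih h.1, ih' h.2⟩
  | til I f f' ih ih' =>
    intro g h
    cases g <;> simp [MTL.code, Nat.pair_eq_pair] at h ⊢
    exact ⟨TimeInterval.code_injective h.1, ih h.2.1, ih' h.2.2⟩

/-- Codes of instances: numbers of symbols, locations and clocks, initial locations, accepting
locations, edges, formula. -/
abbrev ProblemCode := ℕ × ℕ × ℕ × List ℕ × List ℕ × List EdgeCode × ℕ

def Problem.code (P : Problem) : ProblemCode :=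
  (P.numSymbols, P.numLocs, P.numClocks, P.automaton.initial.map Fin.val,
    P.automaton.accepting.map Fin.val, P.automaton.edges.map Edge.code, P.formula.code)

theorem Problem.code_injective : Function.Injective Problem.code := by
  rintro ⟨k, m, c, ⟨i, f, e⟩, p⟩ ⟨k', m', c', ⟨i', f', e'⟩, p'⟩ h
  simp only [Problem.code, Prod.mk.injEq] at h
  obtain ⟨rfl, rfl, rfl, h4, h5, h6, h7⟩ := h
  rw [List.map_injective_iff.2 Fin.val_injective h4, List.map_injective_iff.2 Fin.val_injective h5,
    List.map_injective_iff.2 Edge.code_injective h6, MTL.code_injective h7]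

/-- The encoding of instances, which is one-to-one. -/
def encoding : Problem ↪ ProblemCode := ⟨Problem.code, Problem.code_injective⟩

/-- With respect to the encoding `enc`, some algorithm (total computable function) decides `Q`
on all instances that belong to the class `C`. -/
def DecidableOn {α β : Type} [Primcodable β] (enc : α ↪ β) (C Q : α → Prop) : Prop :=
  ∃ f : β → Bool, Computable f ∧ ∀ a, C a → (f (enc a) = true ↔ Q a)

end DWTAEnergy

namespace DWTAEnergy

/-! ### A fixed Turing machine with an undecidable halting problem. -/

section TuringMachine

open Turing

/-! The halting problem of one fixed Turing machine on the inputs `u v bⁿ` is reduced to the energy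
problem. A computation is written as consecutive rows of a common width `m`: a separator followed by
tape cells, one of which carries the head. Each cell of a row depends only on three neighbouring
cells of the previous row (`localRule_rowCell`). MTL can demand that the image of every window of
three cells occurs exactly one time unit later. This alone leaves room for additional letters
between the images, so that rows could acquire spurious content.

The weight closes this gap. Each of the `m - 1` cells of the first row pushes, the computation
leaves the weight unchanged, and everything after a designated halting letter at position `d` pops.
A non-negative weight then bounds the length of the word by `d + m`. Times are required to increase
strictly, so sending each `n < d` to a position one time unit later is strictly increasing with
values in `[m, d + m)`; such a map can only be `n ↦ n + m` (`eq_add_of_strictMono`). Hence nothing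
was inserted, the word is a trace (`exists_isTrace_of_models`), and a trace forces the machine to
halt (`IsTrace.eval_dom`). Conversely, a halting computation yields a trace (`exists_isTrace`), and
giving its `i`-th letter the time `i / m` satisfies the formula (`models_of_isTrace`).

The automaton has one location and no clocks and reads every timed word, the operation being part of
the letter. The same instances therefore settle both claims. -/

theorem trNat_two_pow (n : ℕ) :
    PartrecToTM2.trNat (2 ^ n) = List.replicate n PartrecToTM2.Γ'.bit0 ++ [PartrecToTM2.Γ'.bit1] := by
  have key : ∀ n : ℕ, ∃ p : PosNum, ((2 ^ n : ℕ) : Num) = Num.pos p ∧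
      PartrecToTM2.trPosNum p =
        List.replicate n PartrecToTM2.Γ'.bit0 ++ [PartrecToTM2.Γ'.bit1] := by
    intro n
    induction n with
    | zero => exact ⟨1, by simp; rfl, rfl⟩
    | succ n ih =>
      obtain ⟨p, hp, hl⟩ := ih
      refine ⟨p.bit0, ?_, by simp [PartrecToTM2.trPosNum, hl, List.replicate_succ]⟩
      rw [pow_succ, mul_two, Nat.cast_add, hp]
      exact congrArg Num.pos p.bit0_of_bit0
  obtain ⟨p, hp, hl⟩ := key n
  rw [PartrecToTM2.trNat, hp, ← hl]
  rfl

/-- Restriction of a Turing machine to a finite supporting set of states. -/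
theorem exists_finite_machine {Γ Λ : Type} [Inhabited Γ] [Inhabited Λ] (M : TM0.Machine Γ Λ)
    (S : Finset Λ) (hS : TM0.Supports M (S : Set Λ)) :
    ∃ (Q : Type) (_ : Fintype Q) (_ : Inhabited Q) (M' : TM0.Machine Γ Q),
      ∀ l, (TM0.eval M' l).Dom ↔ (TM0.eval M l).Dom := by
  classical
  let i : Inhabited S := ⟨⟨default, hS.1⟩⟩
  let g₁ : PointedMap Λ S :=
    ⟨fun q => if h : q ∈ S then ⟨q, h⟩ else default, by
      have : default ∈ S := hS.1
      simp [this]; rfl⟩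
  have hg : ∀ q ∈ (S : Set Λ), ((g₁ q : S) : Λ) = q := by
    intro q hq
    have hq' : q ∈ S := hq
    change ((if h : q ∈ S then (⟨q, h⟩ : S) else default : S) : Λ) = q
    rw [dif_pos hq']
  let f : PointedMap Γ Γ := ⟨id, rfl⟩
  refine ⟨S, inferInstance, i, M.map f f g₁ Subtype.val, fun l => ?_⟩
  have hr := M.map_respects f f g₁ Subtype.val hS (fun _ => rfl) hg
  refine StateTransition.tr_eval_dom hr (a₁ := TM0.init l) ⟨hS.1, ?_⟩
  rw [TM0.map_init]
  congr 1
  exact List.map_id _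

theorem exists_finite_machine_of_stacks {K : Type} [DecidableEq K] {Γ : K → Type} {Λ σ : Type}
    [Inhabited Λ] [Inhabited σ] [Fintype σ] (M : Λ → TM2.Stmt Γ Λ σ) (S : Finset Λ)
    (hS : TM2.Supports M S) :
    ∃ (Q : Type) (_ : Fintype Q) (_ : Inhabited Q) (M' : TM0.Machine (TM2to1.Γ' K Γ) Q),
      ∀ k L, (TM0.eval M' (TM2to1.trInit k L)).Dom ↔
        (StateTransition.eval (TM2.step M) (TM2.init k L)).Dom := by
  obtain ⟨Q, iQ, jQ, M', hM⟩ :=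
    exists_finite_machine _ _ (TM1to0.tr_supports _ (TM2to1.tr_supports (M := M) hS))
  refine ⟨Q, iQ, jQ, M', fun k L => ?_⟩
  rw [hM, TM1to0.tr_eval, TM2to1.tr_eval_dom]
  rfl

/-- Some finite Turing machine has an undecidable halting problem on inputs `u v bⁿ`. -/
theorem exists_undecidable_machine :
    ∃ (Γ Q : Type) (_ : Inhabited Γ) (_ : Fintype Γ) (_ : Fintype Q) (_ : Inhabited Q)
      (M : TM0.Machine Γ Q) (u v b : Γ),
      ¬ ComputablePred fun n : ℕ => (TM0.eval M (u :: v :: List.replicate n b)).Dom := by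
  classical
  -- On the argument `2 ^ n`, this runs the `n`-th program on `0`. Powers of two are used because
  -- their binary expansions have the uniform shape `bⁿ` followed by one digit.
  let f : ℕ →. ℕ := fun m => (Nat.rfind fun n => Part.some (decide (2 ^ n = m))).bind
    fun n => Nat.Partrec.Code.eval (Denumerable.ofNat Nat.Partrec.Code n) 0
  have hf : Partrec f := by
    refine Partrec.bind (Partrec.rfind ?_) ?_
    · have h : Primrec₂ fun (m n : ℕ) => decide (2 ^ n = m) := by
        have : PrimrecRel fun (m n : ℕ) => 2 ^ n = m :=
          Primrec.eq.comp₂ ((Primrec₂.unpaired'.1 Nat.Primrec.pow).comp₂ (Primrec₂.const 2) .right)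
            .left
        exact this.decide
      exact h.to_comp.partrec₂
    · exact Nat.Partrec.Code.eval_part.comp
        ((Computable.ofNat Nat.Partrec.Code).comp Computable.snd) (Computable.const 0)
  have hdom : ∀ n, (f (2 ^ n)).Dom ↔
      (Nat.Partrec.Code.eval (Denumerable.ofNat Nat.Partrec.Code n) 0).Dom := by
    intro n
    have : Nat.rfind (fun k => Part.some (decide (2 ^ k = 2 ^ n)) : ℕ →. Bool) = Part.some n := by
      refine Part.eq_some_iff.2 (Nat.mem_rfind.2 ⟨by simp, fun {m} hm => ?_⟩)
      have : (2 : ℕ) ^ m ≠ 2 ^ n := (Nat.pow_lt_pow_right (by norm_num) hm).ne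
      simp [this]
    simp only [f, this, Part.bind_some]
  obtain ⟨c, hc⟩ := ToPartrec.Code.exists_code (Nat.Partrec'.part_iff₁.2 hf)
  -- Machines start in the default state, so the program `c` is selected through this instance.
  let iΛ : Inhabited PartrecToTM2.Λ' := ⟨PartrecToTM2.trNormal c PartrecToTM2.Cont'.halt⟩
  obtain ⟨Q, iQ, jQ, M, hM⟩ := exists_finite_machine_of_stacks (Γ := fun _ => PartrecToTM2.Γ')
    PartrecToTM2.tr _ (PartrecToTM2.tr_supports c PartrecToTM2.Cont'.halt)
  -- A tape cell after the passage from stacks to one tape: `t` marks the bottom of the stacks, and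
  -- only the main stack is non-empty. The bottom is on the left, so the stack content appears
  -- reversed.
  let cell (t : Bool) (x : PartrecToTM2.Γ') :
      TM2to1.Γ' PartrecToTM2.K' fun _ => PartrecToTM2.Γ' :=
    (t, Function.update (fun _ => none) PartrecToTM2.K'.main (some x))
  let iK : Fintype PartrecToTM2.K' :=
    ⟨{.main, .rev, .aux, .stack}, fun x => by cases x <;> simp⟩
  let iF : Fintype (TM2to1.Γ' PartrecToTM2.K' fun _ => PartrecToTM2.Γ') :=
    inferInstanceAs (Fintype (Bool × (PartrecToTM2.K' → Option PartrecToTM2.Γ')))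
  refine ⟨_, Q, inferInstance, iF, iQ, jQ, M, cell true .cons, cell false .bit1,
    cell false .bit0, fun hcomp => ?_⟩
  have heq : ∀ n, (TM0.eval M (cell true .cons :: cell false .bit1 ::
      List.replicate n (cell false .bit0))).Dom ↔
      (Nat.Partrec.Code.eval (Denumerable.ofNat Nat.Partrec.Code n) 0).Dom := by
    intro n
    have hl : (cell true .cons :: cell false .bit1 :: List.replicate n (cell false .bit0)) =
        TM2to1.trInit PartrecToTM2.K'.main (PartrecToTM2.trList [2 ^ n]) := by
      have : (PartrecToTM2.trList [2 ^ n]).reverse =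
          .cons :: .bit1 :: List.replicate n .bit0 := by
        simp [trNat_two_pow]
      unfold TM2to1.trInit
      rw [this]
      exact congrArg₂ List.cons rfl (congrArg₂ List.cons rfl List.map_replicate.symm)
    rw [hl, hM, ← hdom]
    have hi : TM2.init PartrecToTM2.K'.main (PartrecToTM2.trList [2 ^ n]) =
        PartrecToTM2.init c [2 ^ n] := by
      unfold TM2.init PartrecToTM2.init
      congr 1
      funext k
      cases k <;> rfl
    have hv := hc ⟨[2 ^ n], rfl⟩
    have he := PartrecToTM2.tr_eval c [2 ^ n]
    rw [hi]
    refine (iff_of_eq (congrArg Part.Dom he)).trans ?_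
    change (c.eval [2 ^ n]).Dom ↔ _
    rw [hv]
    rfl
  refine ComputablePred.halting_problem 0 ?_
  obtain ⟨d, hd⟩ := hcomp
  refine ComputablePred.computable_iff.2
    ⟨fun k => decide _, hd.comp Computable.encode, funext fun k => ?_⟩
  simp only [decide_eq_true_eq, eq_iff_iff]
  rw [heq, Denumerable.ofNat_encode]

end TuringMachine

/-! ### Turing machine steps as a local rule on rows of cells. -/

noncomputable section CellularAutomaton

set_option linter.unusedSectionVars false

open Turing

variable {Γ Q : Type} [Inhabited Γ] [Inhabited Q] (M : TM0.Machine Γ Q)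

/-- A letter of a row: `none` separates consecutive rows, `some (γ, h)` is a tape cell with
symbol `γ`, and `h` is the state if the head is on this cell. -/
abbrev Cell (Γ Q : Type) := Option (Γ × Option Q)

/-- The transition function, made total by idling in halted situations. -/
def action (q : Q) (γ : Γ) : Q × TM0.Stmt Γ := (M q γ).getD (q, .write γ)

def stayingState (γ : Γ) (q : Q) : Γ × Option Q :=
  match action M q γ with
  | (_, .move _) => (γ, none)
  | (q', .write γ') => (γ', some q')

open Classical in
/-- The state in which the head leaves a cell in the direction `d`. -/
def departing (d : Dir) : Cell Γ Q → Option Q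
  | some (γ, some q) => if (action M q γ).2 = .move d then some (action M q γ).1 else none
  | _ => none

/-- The content of a cell in the next row, given the cell and its two neighbours. -/
def localRule (a b c : Cell Γ Q) : Cell Γ Q :=
  match b with
  | none => none
  | some (γ, some q) => some (stayingState M γ q)
  | some (γ, none) => some (γ, (departing M .right a).or (departing M .left c))

def applyAction (T : Tape Γ) (a : ℤ) : Q × TM0.Stmt Γ → TM0.Cfg Γ Q × ℤ
  | (q, .move .left) => (⟨q, T.move .left⟩, a - 1)
  | (q, .move .right) => (⟨q, T.move .right⟩, a + 1)
  | (q, .write γ) => (⟨q, T.write γ⟩, a)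

/-- The total transition function on pairs of a configuration and the absolute position of the
head. -/
def nextConf (c : TM0.Cfg Γ Q × ℤ) : TM0.Cfg Γ Q × ℤ :=
  applyAction c.1.Tape c.2 (action M c.1.q c.1.Tape.head)

def conf (l : List Γ) (p : ℤ) (t : ℕ) : TM0.Cfg Γ Q × ℤ := (nextConf M)^[t] (TM0.init l, p)

open Classical in
/-- The `j`-th letter of the row of width `m` that describes a configuration. -/
def rowCell (m : ℕ) (c : TM0.Cfg Γ Q × ℤ) (j : ℕ) : Cell Γ Q :=
  if 0 < j ∧ j < m then
    some (c.1.Tape.nth (j - c.2), if (j : ℤ) = c.2 then some c.1.q else none)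
  else none

def IsHaltingCell (b : Cell Γ Q) : Prop := ∃ γ q, b = some (γ, some q) ∧ M q γ = none

theorem conf_succ (l : List Γ) (p : ℤ) (t : ℕ) :
    conf M l p (t + 1) = nextConf M (conf M l p t) :=
  Function.iterate_succ_apply' _ _ _

theorem nextConf_eq_of_step {c c' : TM0.Cfg Γ Q} (a : ℤ) (h : TM0.step M c = some c') :
    (nextConf M (c, a)).1 = c' := by
  obtain ⟨q, T⟩ := c
  simp only [TM0.step, Option.map_eq_some_iff] at h
  obtain ⟨⟨q', s⟩, hs, rfl⟩ := h
  simp only [nextConf, action, hs, Option.getD_some]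
  rcases s with (_ | _) | _ <;> rfl

theorem nextConf_eq_of_halted {c : TM0.Cfg Γ Q} (a : ℤ) (h : TM0.step M c = none) :
    nextConf M (c, a) = (c, a) := by
  obtain ⟨q, T⟩ := c
  simp only [TM0.step, Option.map_eq_none_iff] at h
  simp [nextConf, applyAction, action, h]

theorem step_eq_none_iff {c : TM0.Cfg Γ Q} :
    TM0.step M c = none ↔ M c.q c.Tape.head = none := by
  obtain ⟨q, T⟩ := c
  simp [TM0.step]

theorem nextConf_snd_le (c : TM0.Cfg Γ Q × ℤ) :
    c.2 - 1 ≤ (nextConf M c).2 ∧ (nextConf M c).2 ≤ c.2 + 1 := by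
  unfold nextConf
  rcases action M c.1.q c.1.Tape.head with ⟨q', (_ | _) | γ⟩ <;> simp only [applyAction] <;> omega

/-- Since `nextConf` idles on halted configurations, its iterates are exactly the reachable
configurations, and halting can be read off at some time `t`. -/
theorem eval_dom_iff (l : List Γ) (p : ℤ) :
    (TM0.eval M l).Dom ↔ ∃ t, M (conf M l p t).1.q (conf M l p t).1.Tape.head = none := by
  have hdom : (TM0.eval M l).Dom ↔ (StateTransition.eval (TM0.step M) (TM0.init l)).Dom := Iff.rfl
  rw [hdom, Part.dom_iff_mem]
  simp only [StateTransition.mem_eval, ← step_eq_none_iff]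
  constructor
  · rintro ⟨c, hr, hc⟩
    suffices ∃ t, (conf M l p t).1 = c by
      obtain ⟨t, rfl⟩ := this
      exact ⟨t, hc⟩
    clear hc
    induction hr with
    | refl => exact ⟨0, rfl⟩
    | tail _ h ih =>
      obtain ⟨t, rfl⟩ := ih
      exact ⟨t + 1, by rw [conf_succ]; exact nextConf_eq_of_step M _ h⟩
  · rintro ⟨t, ht⟩
    refine ⟨_, ?_, ht⟩
    clear ht
    induction t with
    | zero => exact Relation.ReflTransGen.refl
    | succ t ih =>
      rw [conf_succ]
      cases h : TM0.step M (conf M l p t).1 with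
      | none => rwa [nextConf_eq_of_halted M (conf M l p t).2 h]
      | some c =>
        rw [nextConf_eq_of_step M (conf M l p t).2 h]
        exact ih.tail h

theorem rowCell_eq_none {m j : ℕ} (c : TM0.Cfg Γ Q × ℤ) (h : j = 0 ∨ m ≤ j) :
    rowCell m c j = none := by
  unfold rowCell
  rw [if_neg (by omega)]

theorem rowCell_eq_some {m j : ℕ} (c : TM0.Cfg Γ Q × ℤ) (h : 0 < j) (h' : j < m)
    [Decidable ((j : ℤ) = c.2)] :
    rowCell m c j = some (c.1.Tape.nth (j - c.2), if (j : ℤ) = c.2 then some c.1.q else none) := by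
  unfold rowCell
  rw [if_pos ⟨h, h'⟩]
  congr!

theorem departing_rowCell_of_ne {m j : ℕ} {c : TM0.Cfg Γ Q × ℤ} (d : Dir) (h : (j : ℤ) ≠ c.2) :
    departing M d (rowCell m c j) = none := by
  unfold rowCell
  simp only [h, if_false]
  split <;> rfl

open Classical in
theorem departing_rowCell_of_eq {m j : ℕ} {c : TM0.Cfg Γ Q × ℤ} (d : Dir) (h : (j : ℤ) = c.2)
    (h0 : 0 < j) (hm : j < m) :
    departing M d (rowCell m c j) = if (action M c.1.q c.1.Tape.head).2 = .move d then
      some (action M c.1.q c.1.Tape.head).1 else none := by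
  rw [rowCell_eq_some c h0 hm, if_pos h, h, sub_self]
  rfl

/-- The head can only come from the cell itself or a neighbour. It has to lie strictly between the
separators: a head outside the row is invisible there, and its return would be missed by the rule.
-/
theorem localRule_rowCell {m j : ℕ} {c : TM0.Cfg Γ Q × ℤ} (h0 : 0 < c.2) (hm : c.2 < m)
    (hj : 0 < j) (hjm : j < m) :
    localRule M (rowCell m c (j - 1)) (rowCell m c j) (rowCell m c (j + 1)) =
      rowCell m (nextConf M c) j := by
  classical
  obtain ⟨⟨q, T⟩, a⟩ := c
  simp only at h0 hm
  rw [rowCell_eq_some _ hj hjm, rowCell_eq_some _ hj hjm]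
  have hnext : nextConf M (⟨q, T⟩, a) = applyAction T a (action M q T.head) := rfl
  rw [hnext]
  by_cases h : (j : ℤ) = a
  · simp only [h, if_true, sub_self, localRule, stayingState, Turing.Tape.nth_zero]
    generalize action M q T.head = r
    rcases r with ⟨q', (_ | _) | γ⟩
    · have : ¬ a = a - 1 := by omega
      simp [applyAction, this]
    · simp [applyAction]
    · simp [applyAction, Tape.write]
  · simp only [if_neg h, localRule]
    by_cases hr : ((j - 1 : ℕ) : ℤ) = a
    · rw [departing_rowCell_of_eq M _ hr (by omega) (by omega),
        departing_rowCell_of_ne M _ (by simp only; omega)]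
      have hja : (j : ℤ) = a + 1 := by omega
      have h2 : ¬ a + 1 = a - 1 := by omega
      simp only
      generalize action M q T.head = r
      rcases r with ⟨q', (_ | _) | γ⟩ <;> simp [applyAction, hja, h2]
      rw [← Tape.nth_zero, Tape.move_right_nth, zero_add]
    · rw [departing_rowCell_of_ne M _ hr]
      by_cases hl : ((j + 1 : ℕ) : ℤ) = a
      · rw [departing_rowCell_of_eq M _ hl (by omega) (by omega)]
        have hja : (j : ℤ) = a - 1 := by push_cast at hl; omega
        have h2 : ¬ a - 1 = a + 1 := by omega
        simp only
        generalize action M q T.head = r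
        rcases r with ⟨q', (_ | _) | γ⟩ <;> simp [applyAction, hja, h2]
        · rw [← Tape.nth_zero, Tape.move_left_nth, zero_sub]
        · congr 1
          ring
      · rw [departing_rowCell_of_ne M _ hl]
        have h1 : (j : ℤ) ≠ a + 1 := by omega
        have h2 : (j : ℤ) ≠ a - 1 := by push_cast at hl; omega
        have h3 : (j : ℤ) - a ≠ 0 := by omega
        generalize action M q T.head = r
        rcases r with ⟨q', (_ | _) | γ⟩ <;> simp [applyAction, h, h1, h2, h3] <;> congr 1 <;> ring

end CellularAutomaton

/-! ### Traces of rows, and their equivalence with halting. -/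

noncomputable section Traces

set_option linter.unusedSectionVars false

open Turing

variable {Γ Q : Type} [Inhabited Γ] [Inhabited Q] (M : TM0.Machine Γ Q)

def blankCell : Cell Γ Q := some (default, none)

/-- The cells carrying the input, with the head in the initial state on the first one. -/
def inputCells : List Γ → List (Cell Γ Q)
  | [] => []
  | γ :: l => some (γ, some default) :: l.map fun γ' => some (γ', none)

/-- The sequence `x` lists rows of width `m`, the first of which has `w` at the position `p` and
blanks elsewhere; each row arises from the previous one by the local rule, up to an occurrence of
a halting cell at the position `d`. -/
structure IsTrace (w : List (Cell Γ Q)) (p m d : ℕ) (x : ℕ → Cell Γ Q) : Prop where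
  pos : 0 < p
  lt : p + w.length < m
  lt_halt : m < d
  first : x 0 = none
  init : ∀ j, 0 < j → j < m → x j = if j < p then blankCell else w.getD (j - p) blankCell
  sep : x m = none
  rule : ∀ n, 0 < n → n < d → x (n + m) = localRule M (x (n - 1)) (x n) (x (n + 1))
  halt : IsHaltingCell M (x d)

theorem nth_mk₁_natCast (l : List Γ) (k : ℕ) : (Tape.mk₁ l).nth k = l.getI k := by
  rw [Tape.mk₁, Tape.mk₂, Tape.mk'_nth_nat, ListBlank.nth_mk]

theorem nth_mk₁_of_neg (l : List Γ) {i : ℤ} (h : i < 0) : (Tape.mk₁ l).nth i = default := by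
  obtain ⟨k, rfl⟩ : ∃ k : ℕ, i = -(k + 1 : ℕ) := ⟨(-i - 1).toNat, by omega⟩
  change (ListBlank.mk ([] : List Γ)).nth k = default
  rw [ListBlank.nth_mk, List.getI_nil]

theorem rowCell_init {l : List Γ} (hl : l ≠ []) {p m j : ℕ} (h0 : 0 < j) (hj : j < m) :
    rowCell m ((TM0.init l : TM0.Cfg Γ Q), (p : ℤ)) j =
      if j < p then blankCell else (inputCells l).getD (j - p) blankCell := by
  classical
  rw [rowCell_eq_some _ h0 hj]
  simp only [TM0.init]
  split_ifs with h1 h2 h2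
  · omega
  · have : j = p := by omega
    subst this
    obtain ⟨γ, l, rfl⟩ := List.exists_cons_of_ne_nil hl
    have := nth_mk₁_natCast (γ :: l) 0
    simp only [Nat.cast_zero] at this
    simp [inputCells, this]
  · rw [nth_mk₁_of_neg _ (by omega)]
    rfl
  · obtain ⟨k, rfl⟩ : ∃ k, j = p + (k + 1) := ⟨j - p - 1, by omega⟩
    obtain ⟨γ, l, rfl⟩ := List.exists_cons_of_ne_nil hl
    have h3 : ((p + (k + 1) : ℕ) : ℤ) - p = ((k + 1 : ℕ) : ℤ) := by push_cast; ring
    rw [h3, nth_mk₁_natCast, add_tsub_cancel_left]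
    rw [List.getI_eq_getElem?_getD]
    simp only [inputCells, List.getD_eq_getElem?_getD, List.getElem?_cons_succ, List.getElem?_map,
      blankCell]
    cases l[k]? <;> rfl

theorem rowCell_head_eq_none {m j : ℕ} {c : TM0.Cfg Γ Q × ℤ} (h : ¬ (0 < c.2 ∧ c.2 < m)) (γ q) :
    rowCell m c j ≠ some (γ, some q) := by
  unfold rowCell
  split
  · rw [if_neg (by omega)]
    simp
  · simp

/-- The rule moves heads but creates none, so a row that has lost its head is followed by headless
rows only. This prevents a row that is too narrow from producing a false halting cell. -/
theorem localRule_headless {a b c : Cell Γ Q} (ha : ∀ γ q, a ≠ some (γ, some q))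
    (hb : ∀ γ q, b ≠ some (γ, some q)) (hc : ∀ γ q, c ≠ some (γ, some q)) (γ q) :
    localRule M a b c ≠ some (γ, some q) := by
  have hd : ∀ (d : Dir) (e : Cell Γ Q), (∀ γ q, e ≠ some (γ, some q)) → departing M d e = none := by
    rintro d (_ | ⟨γ, _ | q⟩) he
    · rfl
    · rfl
    · exact absurd rfl (he γ q)
  rcases b with _ | ⟨γ', _ | q'⟩
  · simp [localRule]
  · simp [localRule, hd _ a ha, hd _ c hc]
  · exact absurd rfl (hb γ' q')

theorem localRule_none (a c : Cell Γ Q) : localRule M a none c = none := rfl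

/-- The head has stayed inside the row up to time `t`. -/
def StaysInside (l : List Γ) (p m t : ℕ) : Prop :=
  ∀ s ≤ t, 0 < (conf M l p s).2 ∧ (conf M l p s).2 < m

theorem div_mod_pred {n m : ℕ} (h : 0 < n % m) : (n - 1) / m = n / m ∧ (n - 1) % m = n % m - 1 := by
  rcases Nat.eq_zero_or_pos m with rfl | hm
  · simp
  · have h1 : n - 1 = m * (n / m) + (n % m - 1) := by have := Nat.div_add_mod n m; omega
    have h2 : n % m - 1 < m := by have := Nat.mod_lt n hm; omega
    rw [h1, Nat.mul_add_div hm, Nat.mul_add_mod, Nat.div_eq_of_lt h2, Nat.mod_eq_of_lt h2]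
    simp

theorem div_mod_succ {n m : ℕ} (h : n % m + 1 < m) :
    (n + 1) / m = n / m ∧ (n + 1) % m = n % m + 1 := by
  have hm : 0 < m := by omega
  have h1 : n + 1 = m * (n / m) + (n % m + 1) := by have := Nat.div_add_mod n m; omega
  rw [h1, Nat.mul_add_div hm, Nat.mul_add_mod, Nat.div_eq_of_lt h, Nat.mod_eq_of_lt h]
  simp

theorem mod_succ_eq_zero {n m : ℕ} (h : n % m + 1 = m) : (n + 1) % m = 0 := by
  have h1 : n + 1 = m * (n / m) + m := by have := Nat.div_add_mod n m; omega
  rw [h1, Nat.mul_add_mod, Nat.mod_self]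

namespace IsTrace

variable {M} {l : List Γ} {p m d : ℕ} {x : ℕ → Cell Γ Q}

/-- The three claims need a joint induction: separators recur at multiples of `m`, rows agree with
the machine while the head stays inside, and afterwards they are headless. The last alternative
concerns the whole history, since the true head might return while the row cannot show it. -/
theorem eq_rowCell (h : IsTrace M (inputCells l) p m d x) (hl : l ≠ []) (n : ℕ) (hn : n < d + m) :
    (n % m = 0 → x n = none) ∧
    (StaysInside M l p m (n / m) → x n = rowCell m (conf M l p (n / m)) (n % m)) ∧
    (¬ StaysInside M l p m (n / m) → ∀ γ q, x n ≠ some (γ, some q)) := by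
  have hpm : p < m := by have := h.lt; omega
  have hm : 0 < m := by omega
  induction n using Nat.strong_induction_on with
  | _ n ih =>
  have hsep : n % m = 0 → x n = none := by
    intro h0
    rcases Nat.lt_or_ge n m with hlt | hge
    · rw [Nat.mod_eq_of_lt hlt] at h0
      rw [h0, h.first]
    · obtain ⟨k, rfl⟩ := Nat.exists_eq_add_of_le' hge
      rw [Nat.add_mod_right] at h0
      rcases Nat.eq_zero_or_pos k with rfl | hk
      · rw [zero_add, h.sep]
      · rw [h.rule k hk (by omega), (ih k (by omega) (by omega)).1 h0, localRule_none]
  refine ⟨hsep, ?_⟩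
  rcases Nat.eq_zero_or_pos (n % m) with h0 | h0
  · rw [hsep h0, h0]
    exact ⟨fun _ => (rowCell_eq_none _ (Or.inl rfl)).symm, fun _ => by simp⟩
  rcases Nat.lt_or_ge n m with hlt | hge
  · rw [Nat.mod_eq_of_lt hlt] at h0 ⊢
    rw [Nat.div_eq_of_lt hlt]
    refine ⟨fun _ => ?_, fun hs => absurd ?_ hs⟩
    · rw [h.init n h0 hlt]
      exact (rowCell_init hl h0 hlt).symm
    · intro s hs
      obtain rfl : s = 0 := by omega
      exact ⟨Int.natCast_pos.2 h.pos, Int.ofNat_lt.2 hpm⟩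
  · obtain ⟨k, rfl⟩ := Nat.exists_eq_add_of_le' hge
    rw [Nat.add_mod_right] at h0
    rw [Nat.add_mod_right, Nat.add_div_right _ hm]
    have hk : 0 < k := Nat.pos_of_ne_zero fun e => by simp [e] at h0
    have hm2 : k % m < m := Nat.mod_lt _ hm
    have i1 := ih (k - 1) (by omega) (by omega)
    have i2 := ih k (by omega) (by omega)
    have i3 := ih (k + 1) (by omega) (by omega)
    obtain ⟨e1, e2⟩ := div_mod_pred h0
    rw [e1, e2] at i1
    rw [h.rule k hk (by omega), conf_succ]
    by_cases hs : StaysInside M l p m (k / m)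
    · have hin := hs _ le_rfl
      -- At the end of a row the right neighbour is the separator of the next row, which `rowCell`
      -- also provides at index `m`.
      have i3' : x (k + 1) = rowCell m (conf M l p (k / m)) (k % m + 1) := by
        rcases Nat.lt_or_ge (k % m + 1) m with h1 | h1
        · obtain ⟨e3, e4⟩ := div_mod_succ h1
          rw [e3, e4] at i3
          exact i3.2.1 hs
        · rw [i3.1 (mod_succ_eq_zero (by omega)), rowCell_eq_none _ (Or.inr h1)]
      rw [i1.2.1 hs, i2.2.1 hs, i3', localRule_rowCell M hin.1 hin.2 h0 hm2]
      refine ⟨fun _ => rfl, fun hns => rowCell_head_eq_none fun hin' => hns ?_⟩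
      intro s hs'
      rcases Nat.lt_or_ge (k / m) s with h1 | h1
      · obtain rfl : s = k / m + 1 := by omega
        rwa [conf_succ]
      · exact hs s h1
    · refine ⟨fun hs' => absurd (fun s h' => hs' s (by omega)) hs, fun _ => ?_⟩
      refine localRule_headless M (i1.2.2 hs) (i2.2.2 hs) ?_
      rcases Nat.lt_or_ge (k % m + 1) m with h1 | h1
      · obtain ⟨e3, e4⟩ := div_mod_succ h1
        rw [e3, e4] at i3
        exact i3.2.2 hs
      · rw [i3.1 (mod_succ_eq_zero (by omega))]
        simp

theorem eval_dom (h : IsTrace M (inputCells l) p m d x) (hl : l ≠ []) : (TM0.eval M l).Dom := by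
  classical
  have hpm : p < m := by have := h.lt; omega
  obtain ⟨-, h1, h2⟩ := h.eq_rowCell hl d (by omega)
  obtain ⟨γ, q, hx, hM⟩ := h.halt
  by_cases hs : StaysInside M l p m (d / m)
  · refine (eval_dom_iff M l p).2 ⟨d / m, ?_⟩
    rw [h1 hs] at hx
    unfold rowCell at hx
    split at hx
    · simp only [Option.some.injEq, Prod.mk.injEq] at hx
      obtain ⟨hγ, hq⟩ := hx
      split at hq
      · rename_i he
        rw [he, sub_self, Tape.nth_zero] at hγ
        rw [Option.some.injEq] at hq
        rw [hγ, hq, hM]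
      · simp at hq
    · simp at hx
  · exact absurd hx (h2 hs γ q)

end IsTrace

theorem abs_conf_sub_le (l : List Γ) (p : ℤ) (t : ℕ) :
    p - t ≤ (conf M l p t).2 ∧ (conf M l p t).2 ≤ p + t := by
  induction t with
  | zero => simp [conf]
  | succ t ih =>
    rw [conf_succ]
    have := nextConf_snd_le M (conf M l p t)
    push_cast
    omega

theorem nextConf_fst (c : TM0.Cfg Γ Q) (a b : ℤ) :
    (nextConf M (c, a)).1 = (nextConf M (c, b)).1 := by
  simp only [nextConf]
  rcases action M c.q c.Tape.head with ⟨q', (_ | _) | γ⟩ <;> rfl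

/-- The offset of the input in the row may thus be chosen after the halting time is known. -/
theorem conf_fst (l : List Γ) (a b : ℤ) (t : ℕ) : (conf M l a t).1 = (conf M l b t).1 := by
  induction t with
  | zero => rfl
  | succ t ih =>
    have h : nextConf M (conf M l a t) = nextConf M ((conf M l b t).1, (conf M l a t).2) := by
      rw [← ih]
    rw [conf_succ, conf_succ, h]
    exact nextConf_fst M _ _ _

theorem length_inputCells (l : List Γ) : (inputCells l : List (Cell Γ Q)).length = l.length := by
  cases l <;> simp [inputCells]

/-- A halting computation has a trace. -/
theorem exists_isTrace {l : List Γ} (hl : l ≠ []) (h : (TM0.eval M l).Dom) :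
    ∃ p m d x, IsTrace M (inputCells l) p m d x := by
  classical
  obtain ⟨t, ht⟩ := (eval_dom_iff M l 0).1 h
  -- In `t + 1` steps the head moves by at most `t + 1` cells; these margins keep it strictly
  -- between the separators.
  obtain ⟨p, hp⟩ : ∃ p, p = t + 2 := ⟨_, rfl⟩
  obtain ⟨m, hm⟩ : ∃ m, m = p + l.length + t + 3 := ⟨_, rfl⟩
  have hin : ∀ s ≤ t + 1, 0 < (conf M l p s).2 ∧ (conf M l p s).2 < m := by
    intro s hs
    have := abs_conf_sub_le M l p s
    omega
  rw [conf_fst M l 0 p] at ht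
  -- The halted machine idles for one more row. Taking the halting cell from row `t + 1` ensures `m
  -- < d` even if `t = 0`.
  have hlast : conf M l p (t + 1) = conf M l p t := by
    rw [conf_succ]
    exact nextConf_eq_of_halted M _ ((step_eq_none_iff M).2 ht)
  rw [← hlast] at ht
  obtain ⟨j, hj⟩ := Int.eq_ofNat_of_zero_le (hin (t + 1) le_rfl).1.le
  have hjm := hin (t + 1) le_rfl
  rw [hj] at hjm
  have hj0 : 0 < j := by omega
  have hjm : j < m := by omega
  have hm0 : 0 < m := by omega
  have hdiv : (m * (t + 1) + j) / m = t + 1 := by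
    rw [Nat.mul_add_div hm0, Nat.div_eq_of_lt hjm, add_zero]
  have hmod : (m * (t + 1) + j) % m = j := by
    rw [Nat.mul_add_mod, Nat.mod_eq_of_lt hjm]
  have hrow : ∀ c : TM0.Cfg Γ Q × ℤ, rowCell m c 0 = none :=
    fun c => rowCell_eq_none c (Or.inl rfl)
  refine ⟨p, m, m * (t + 1) + j, fun n => rowCell m (conf M l p (n / m)) (n % m), by omega, ?_, ?_,
    ?_, ?_, ?_, ?_, ?_⟩
  · rw [length_inputCells]
    omega
  · have : m * 1 ≤ m * (t + 1) := Nat.mul_le_mul_left m (by omega)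
    omega
  · simp only [Nat.zero_mod, hrow]
  · intro k h0 hk
    simp only [Nat.mod_eq_of_lt hk, Nat.div_eq_of_lt hk]
    exact rowCell_init hl h0 hk
  · simp only [Nat.mod_self, hrow]
  · intro n h0 hn
    have hnt : n / m ≤ t + 1 := hdiv ▸ Nat.div_le_div_right hn.le
    simp only [Nat.add_mod_right, Nat.add_div_right _ hm0]
    rcases Nat.eq_zero_or_pos (n % m) with hz | hz
    · rw [hz, hrow, hrow, localRule_none]
    · have hm2 : n % m < m := Nat.mod_lt _ hm0
      obtain ⟨e1, e2⟩ := div_mod_pred hz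
      have e3 : rowCell m (conf M l p ((n + 1) / m)) ((n + 1) % m) =
          rowCell m (conf M l p (n / m)) (n % m + 1) := by
        rcases Nat.lt_or_ge (n % m + 1) m with h1 | h1
        · obtain ⟨e3, e4⟩ := div_mod_succ h1
          rw [e3, e4]
        · rw [mod_succ_eq_zero (by omega), hrow, rowCell_eq_none _ (Or.inr h1)]
      rw [e1, e2, e3, localRule_rowCell M (hin _ hnt).1 (hin _ hnt).2 hz hm2, conf_succ]
  · simp only [hdiv, hmod]
    refine ⟨_, _, ?_, ht⟩
    rw [rowCell_eq_some _ hj0 hjm, hj, if_pos rfl]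
    simp

end Traces

/-! ### Derived MTL operators and their semantics. -/

section Logic

variable {S : Type}

namespace TimeInterval

def unbounded : TimeInterval := ⟨0, true, none, true⟩

def singleton (n : ℕ) : TimeInterval := ⟨n, true, some n, true⟩

theorem mem_unbounded {x : ℝ} : x ∈ unbounded.toSet ↔ 0 ≤ x := by
  simp [unbounded, toSet]

theorem mem_singleton {n : ℕ} {x : ℝ} : x ∈ (singleton n).toSet ↔ x = n := by
  have : (∀ u : ℕ, n ≤ u → u ≤ n → x ≤ u) ↔ x ≤ n :=
    ⟨fun h => h n le_rfl le_rfl, fun h u h1 h2 => by rwa [← le_antisymm h1 h2]⟩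
  simp [singleton, toSet, le_antisymm_iff, this, and_comm]

end TimeInterval

namespace TimedWord

variable (w : TimedWord S)

/-- Letters and times become total functions on `ℕ`, so that positions can be shifted freely; the
values outside the word are arbitrary. -/
def letterAt (i : ℕ) : S := if h : i < w.len then w.letter ⟨i, h⟩ else w.letter ⟨0, w.len_pos⟩

def timeAt (i : ℕ) : ℝ := if h : i < w.len then w.time ⟨i, h⟩ else 0

/-- The formula `f` holds at the position `i`, and this is a position of the word. -/
def Models (f : MTL S) (i : ℕ) : Prop := ∃ h : i < w.len, f.SatAt w ⟨i, h⟩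

theorem letterAt_of_lt {i : ℕ} (h : i < w.len) : w.letterAt i = w.letter ⟨i, h⟩ := dif_pos h

theorem timeAt_of_lt {i : ℕ} (h : i < w.len) : w.timeAt i = w.time ⟨i, h⟩ := dif_pos h

theorem timeAt_mono {i j : ℕ} (h : i ≤ j) (hj : j < w.len) : w.timeAt i ≤ w.timeAt j := by
  rw [w.timeAt_of_lt hj, w.timeAt_of_lt (h.trans_lt hj)]
  exact_mod_cast w.mono (Fin.mk_le_mk.2 h)

variable {w}

theorem satisfies_iff {f : MTL S} : w.Satisfies f ↔ w.Models f 0 :=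
  ⟨fun h => ⟨w.len_pos, h⟩, fun ⟨_, h⟩ => h⟩

theorem models_tt {i : ℕ} : w.Models .tt i ↔ i < w.len := by simp [Models, MTL.SatAt]

theorem models_atom {a : S} {i : ℕ} : w.Models (.atom a) i ↔ i < w.len ∧ w.letterAt i = a := by
  simp only [Models, MTL.SatAt]
  exact ⟨fun ⟨h, e⟩ => ⟨h, by rwa [w.letterAt_of_lt h]⟩,
    fun ⟨h, e⟩ => ⟨h, by rwa [← w.letterAt_of_lt h]⟩⟩

theorem models_neg {f : MTL S} {i : ℕ} : w.Models f.neg i ↔ i < w.len ∧ ¬ w.Models f i := by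
  simp only [Models, MTL.SatAt, not_exists]
  exact ⟨fun ⟨h, e⟩ => ⟨h, fun _ => e⟩, fun ⟨h, e⟩ => ⟨h, e h⟩⟩

theorem models_conj {f g : MTL S} {i : ℕ} :
    w.Models (f.conj g) i ↔ w.Models f i ∧ w.Models g i := by
  simp only [Models, MTL.SatAt]
  exact ⟨fun ⟨h, e, e'⟩ => ⟨⟨h, e⟩, h, e'⟩, fun ⟨⟨h, e⟩, _, e'⟩ => ⟨h, e, e'⟩⟩

theorem models_til {I : TimeInterval} {f g : MTL S} {i : ℕ} :
    w.Models (.til I f g) i ↔ ∃ j, i < j ∧ w.Models g j ∧ w.timeAt j - w.timeAt i ∈ I.toSet ∧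
      ∀ k, i < k → k < j → w.Models f k := by
  simp only [Models, MTL.SatAt]
  constructor
  · rintro ⟨h, ⟨j, hj⟩, hij, hg, hI, hf⟩
    refine ⟨j, hij, ⟨hj, hg⟩, ?_, fun k hik hkj => ⟨hkj.trans hj, hf _ hik hkj⟩⟩
    rwa [w.timeAt_of_lt hj, w.timeAt_of_lt h]
  · rintro ⟨j, hij, ⟨hj, hg⟩, hI, hf⟩
    refine ⟨hij.trans hj, ⟨j, hj⟩, hij, hg, ?_, fun k hik hkj => (hf k hik hkj).2⟩
    rwa [w.timeAt_of_lt hj, w.timeAt_of_lt (hij.trans hj)] at hI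

theorem Models.lt {f : MTL S} {i : ℕ} (h : w.Models f i) : i < w.len := h.1

end TimedWord

namespace MTL

/-- `f U g` without a time constraint. -/
def untl (f g : MTL S) : MTL S := .til .unbounded f g

def next (f : MTL S) : MTL S := untl (.neg .tt) f

/-- Strictly later, `f` holds. -/
def eventually (f : MTL S) : MTL S := untl .tt f

/-- From now on, `f` holds. -/
def globally (f : MTL S) : MTL S := .conj f (.neg (eventually (.neg f)))

/-- Exactly one time unit later, `f` holds. -/
def afterOne (f : MTL S) : MTL S := .til (.singleton 1) .tt f

def bigConj : List (MTL S) → MTL S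
  | [] => .tt
  | f :: l => .conj f (bigConj l)

open Classical in
/-- The current letter satisfies `P`. -/
noncomputable def letterIn [Fintype S] (P : S → Prop) : MTL S :=
  .neg (bigConj ((Finset.univ.filter P).toList.map fun a => .neg (.atom a)))

end MTL

namespace TimedWord

variable {w : TimedWord S}

theorem models_untl {f g : MTL S} {i : ℕ} :
    w.Models (f.untl g) i ↔ ∃ j, i < j ∧ w.Models g j ∧ ∀ k, i < k → k < j → w.Models f k := by
  simp only [MTL.untl, models_til, TimeInterval.mem_unbounded]
  exact ⟨fun ⟨j, h, hg, _, hf⟩ => ⟨j, h, hg, hf⟩,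
    fun ⟨j, h, hg, hf⟩ => ⟨j, h, hg, sub_nonneg.2 (w.timeAt_mono h.le hg.lt), hf⟩⟩

theorem models_next {f : MTL S} {i : ℕ} : w.Models f.next i ↔ w.Models f (i + 1) := by
  simp only [MTL.next, models_untl, models_neg, models_tt]
  constructor
  · rintro ⟨j, hj, hf, h⟩
    obtain rfl : j = i + 1 := by
      by_contra hne
      exact (h (i + 1) (by omega) (by omega)).2 (h (i + 1) (by omega) (by omega)).1
    exact hf
  · exact fun h => ⟨i + 1, by omega, h, fun k _ _ => by omega⟩

theorem models_eventually {f : MTL S} {i : ℕ} :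
    w.Models f.eventually i ↔ ∃ j, i < j ∧ w.Models f j := by
  simp only [MTL.eventually, models_untl, models_tt]
  exact ⟨fun ⟨j, h, hf, _⟩ => ⟨j, h, hf⟩,
    fun ⟨j, h, hf⟩ => ⟨j, h, hf, fun k _ hk => hk.trans hf.lt⟩⟩

theorem models_globally {f : MTL S} {i : ℕ} :
    w.Models f.globally i ↔ i < w.len ∧ ∀ j, i ≤ j → j < w.len → w.Models f j := by
  simp only [MTL.globally, models_conj, models_neg, models_eventually]
  constructor
  · rintro ⟨h, hi, hn⟩
    refine ⟨hi, fun j hij hj => ?_⟩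
    rcases hij.eq_or_lt with rfl | hij
    · exact h
    · by_contra hc
      exact hn ⟨j, hij, hj, hc⟩
  · rintro ⟨hi, h⟩
    exact ⟨h i le_rfl hi, hi, fun ⟨j, hij, hj, hn⟩ => hn (h j hij.le hj)⟩

theorem models_afterOne {f : MTL S} {i : ℕ} :
    w.Models f.afterOne i ↔ ∃ j, i < j ∧ w.Models f j ∧ w.timeAt j = w.timeAt i + 1 := by
  simp only [MTL.afterOne, models_til, models_tt, TimeInterval.mem_singleton, Nat.cast_one,
    sub_eq_iff_eq_add']
  exact ⟨fun ⟨j, h, hf, ht, _⟩ => ⟨j, h, hf, ht⟩,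
    fun ⟨j, h, hf, ht⟩ => ⟨j, h, hf, ht, fun k _ hk => hk.trans hf.lt⟩⟩

theorem models_bigConj {l : List (MTL S)} {i : ℕ} :
    w.Models (MTL.bigConj l) i ↔ i < w.len ∧ ∀ f ∈ l, w.Models f i := by
  induction l with
  | nil => simp [MTL.bigConj, models_tt]
  | cons f l ih =>
    simp only [MTL.bigConj, models_conj, ih, List.forall_mem_cons]
    exact ⟨fun ⟨h, h', h''⟩ => ⟨h', h, h''⟩, fun ⟨h', h, h''⟩ => ⟨h, h', h''⟩⟩

theorem models_letterIn [Fintype S] {P : S → Prop} {i : ℕ} :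
    w.Models (MTL.letterIn P) i ↔ i < w.len ∧ P (w.letterAt i) := by
  simp only [MTL.letterIn, models_neg, models_bigConj, List.mem_map, Finset.mem_toList,
    Finset.mem_filter, Finset.mem_univ, true_and, forall_exists_index, and_imp,
    forall_apply_eq_imp_iff₂, models_atom]
  refine and_congr_right fun h => ⟨fun hn => ?_, fun hP hn => (hn.2 _ hP).2 ⟨h, rfl⟩⟩
  by_contra hP
  exact hn ⟨h, fun a ha => ⟨h, fun ⟨_, e⟩ => hP (e ▸ ha)⟩⟩

end TimedWord

end Logic

/-! ### The formula describing encoded computations. -/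

noncomputable section Specification

open Turing

variable {Γ Q S : Type} [Inhabited Γ] [Inhabited Q] [Fintype S] (cell : S → Cell Γ Q)
  (op : S → CounterOp)

namespace MTL

def isLetter (a : Cell Γ Q) (o : CounterOp) : MTL S := letterIn fun s => cell s = a ∧ op s = o

/-- The next positions carry the cells in the list, with the operation `push`; then `g` holds. -/
def listed (g : MTL S) : List (Cell Γ Q) → MTL S
  | [] => g
  | a :: l => .conj (isLetter cell op a .push) (next (listed g l))

variable (M : TM0.Machine Γ Q)

/-- Halting cells may also occur among the final pops. Requiring `noop` excludes them, so that no
copies are demanded there. -/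
def haltingLetter : MTL S := letterIn fun s => IsHaltingCell M (cell s) ∧ op s = .noop

def halting : MTL S :=
  .conj (haltingLetter cell op M)
    (.neg (eventually (.neg (letterIn fun s => op s = .pop))))

def separator : MTL S := isLetter cell op none .noop

def computation : MTL S :=
  .conj (separator cell op) (untl (letterIn fun s => op s = .noop) (halting cell op M))

/-- The explicit blank, together with the strict until, puts at least one blank after the input;
hence the strict bound `p + w.length < m` in `IsTrace`. -/
def paddedComputation : MTL S :=
  .conj (isLetter cell op blankCell .push)
    (untl (isLetter cell op blankCell .push) (computation cell op M))

/-- The shape of the word: first row with cells `l`, computation, first halting cell, and rest. -/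
def shape (l : List (Cell Γ Q)) : MTL S :=
  .conj (separator cell op) (untl (isLetter cell op blankCell .push)
    (listed cell op (paddedComputation cell op M) l))

/-- Consecutive positions have different times. -/
def strictTimes : MTL S := globally (.neg (.til (.singleton 0) (.neg .tt) .tt))

/-- A window of three cells is copied, in the sense of the local rule, one time unit later, as
long as a halting letter is still to come. -/
def copyWindow (a b c : Cell Γ Q) : MTL S :=
  globally (.neg (.conj (letterIn fun s => cell s = a) (next (.conj (letterIn fun s => cell s = b)
    (.conj (next (letterIn fun s => cell s = c)) (.conj (eventually (haltingLetter cell op M))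
      (.neg (afterOne (letterIn fun s => cell s = localRule M a b c)))))))))

/-- Position `0` is not the middle of any window, so its image is demanded separately. As a
separator with `noop`, this image cannot lie among the pushes of the first row, which anchors the
copying at `m` or later. -/
def dynamics [Fintype Γ] [Fintype Q] : MTL S :=
  .conj (afterOne (separator cell op)) (.conj strictTimes
    (bigConj ((Finset.univ : Finset (Cell Γ Q × Cell Γ Q × Cell Γ Q)).toList.map fun t =>
      copyWindow cell op M t.1 t.2.1 t.2.2)))

end MTL

end Specification

/-! ### Words of non-negative weight satisfying the formula are traces, and conversely. -/

noncomputable section Semantics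

set_option linter.unusedSectionVars false

open Turing

/-- The operations along a word with first row of width `m` and first halting cell at `d`. -/
def phase (m d i : ℕ) : CounterOp :=
  if i = 0 then .noop else if i < m then .push else if i ≤ d then .noop else .pop

/-- Among the first `n` letters, the two truncated differences count the pushes and the pops. -/
theorem sum_phase {m d : ℕ} (hm : 0 < m) (hd : m ≤ d) (n : ℕ) :
    ∑ i ∈ Finset.range n, (phase m d i).effect =
      ((min n m - 1 : ℕ) : ℤ) - ((n - 1 - d : ℕ) : ℤ) := by
  induction n with
  | zero => simp
  | succ n ih =>
    rw [Finset.sum_range_succ, ih]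
    unfold phase
    split_ifs <;> simp only [CounterOp.effect] <;> omega

variable {Γ Q S : Type} [Inhabited Γ] [Inhabited Q] [Fintype S] {cell : S → Cell Γ Q}
  {op : S → CounterOp} {M : TM0.Machine Γ Q} {w : TimedWord S}

open TimedWord

theorem models_isLetter {a : Cell Γ Q} {o : CounterOp} {i : ℕ} :
    w.Models (MTL.isLetter cell op a o) i ↔
      i < w.len ∧ cell (w.letterAt i) = a ∧ op (w.letterAt i) = o :=
  models_letterIn

theorem models_listed {g : MTL S} {l : List (Cell Γ Q)} {i : ℕ} :
    w.Models (MTL.listed cell op g l) i ↔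
      (∀ k a, l[k]? = some a → w.Models (MTL.isLetter cell op a .push) (i + k)) ∧
        w.Models g (i + l.length) := by
  induction l generalizing i with
  | nil => simp [MTL.listed]
  | cons b l ih =>
    simp only [MTL.listed, models_conj, models_next, ih, List.length_cons]
    rw [← and_assoc, show i + (l.length + 1) = i + 1 + l.length by omega]
    refine and_congr_left fun _ => ⟨fun ⟨h0, h⟩ k a hk => ?_, fun h => ⟨h 0 b rfl, fun k a hk => ?_⟩⟩
    · cases k with
      | zero =>
        obtain rfl : b = a := by simpa using hk
        exact h0
      | succ k =>
        rw [show i + (k + 1) = i + 1 + k by omega]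
        exact h k a (by simpa using hk)
    · rw [show i + 1 + k = i + (k + 1) by omega]
      exact h (k + 1) a (by simpa using hk)

theorem models_halting {i : ℕ} :
    w.Models (MTL.halting cell op M) i ↔ i < w.len ∧ IsHaltingCell M (cell (w.letterAt i)) ∧
      op (w.letterAt i) = .noop ∧ ∀ j, i < j → j < w.len → op (w.letterAt j) = .pop := by
  simp only [MTL.halting, MTL.haltingLetter, models_conj, models_letterIn, models_neg,
    models_eventually]
  constructor
  · rintro ⟨⟨h, h1, h2⟩, -, h3⟩
    refine ⟨h, h1, h2, fun j hij hj => ?_⟩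
    by_contra hc
    exact h3 ⟨j, hij, hj, fun h => hc h.2⟩
  · rintro ⟨h, h1, h2, h3⟩
    exact ⟨⟨h, h1, h2⟩, h, fun ⟨j, hij, hj, hc⟩ => hc ⟨hj, h3 j hij hj⟩⟩

/-- The witnesses of the nested untils are `p`, where the input begins, `m`, the second separator,
and `d`, the halting letter after which only pops follow. -/
theorem models_shape {l : List (Cell Γ Q)} :
    w.Models (MTL.shape cell op M l) 0 ↔ ∃ p m d, 0 < p ∧ p + l.length < m ∧ m < d ∧ d < w.len ∧
      cell (w.letterAt 0) = none ∧
      (∀ j, 0 < j → j < m →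
        cell (w.letterAt j) = if j < p then blankCell else l.getD (j - p) blankCell) ∧
      cell (w.letterAt m) = none ∧ IsHaltingCell M (cell (w.letterAt d)) ∧
      ∀ i < w.len, op (w.letterAt i) = phase m d i := by
  simp only [MTL.shape, MTL.paddedComputation, MTL.computation, MTL.separator, models_conj,
    models_untl, models_listed, models_isLetter, models_letterIn, models_halting]
  constructor
  · rintro ⟨⟨-, hc0, ho0⟩, p, hp, ⟨hl, ⟨hr, hcr, hor⟩, m, hm, ⟨⟨hmlt, hcm, hom⟩, d, hmd,
      ⟨hd, hhalt, hod, hpop⟩, hmid⟩, hbl2⟩, hbl1⟩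
    have key : ∀ j, 0 < j → j < m →
        cell (w.letterAt j) = (if j < p then blankCell else l.getD (j - p) blankCell) ∧
          op (w.letterAt j) = .push := by
      intro j h0 hj
      split_ifs with h1
      · exact (hbl1 j h0 h1).2
      · obtain ⟨k, rfl⟩ := Nat.exists_eq_add_of_le (not_lt.1 h1)
        rw [add_tsub_cancel_left, List.getD_eq_getElem?_getD]
        cases hk : l[k]? with
        | some a => exact (hl k a hk).2
        | none =>
          rw [List.getElem?_eq_none_iff] at hk
          rcases hk.eq_or_lt with rfl | hk
          · exact ⟨hcr, hor⟩
          · exact (hbl2 _ (by omega) hj).2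
    refine ⟨p, m, d, hp, hm, hmd, hd, hc0, fun j h0 hj => (key j h0 hj).1, hcm, hhalt,
      fun i hi => ?_⟩
    unfold phase
    split_ifs with h1 h2 h3
    · rw [h1, ho0]
    · exact (key i (by omega) h2).2
    · rcases (not_lt.1 h2).eq_or_lt with rfl | h2
      · exact hom
      · rcases h3.eq_or_lt with rfl | h3
        · exact hod
        · exact (hmid i h2 h3).2
    · exact hpop i (by omega) hi
  · rintro ⟨p, m, d, hp, hm, hmd, hd, hc0, hinit, hcm, hhalt, hop⟩
    have hpush : ∀ j, 0 < j → j < m → op (w.letterAt j) = .push := by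
      intro j h0 hj
      rw [hop j (by omega), phase, if_neg (by omega), if_pos hj]
    have hnoop : ∀ j, m ≤ j → j ≤ d → op (w.letterAt j) = .noop := by
      intro j h0 hj
      rw [hop j (by omega), phase, if_neg (by omega), if_neg (by omega), if_pos hj]
    have hpop : ∀ j, d < j → j < w.len → op (w.letterAt j) = .pop := by
      intro j h0 hj
      rw [hop j hj, phase, if_neg (by omega), if_neg (by omega), if_neg (by omega)]
    have hblank : ∀ j, p + l.length ≤ j → j < m → cell (w.letterAt j) = blankCell := by
      intro j h0 hj
      rw [hinit j (by omega) hj, if_neg (by omega), List.getD_eq_getElem?_getD,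
        List.getElem?_eq_none (by omega), Option.getD_none]
    refine ⟨⟨w.len_pos, hc0, ?_⟩, p, hp, ⟨fun k a hk => ?_, ⟨by omega, hblank _ le_rfl hm,
      hpush _ (by omega) hm⟩, m, hm, ⟨⟨by omega, hcm, hnoop _ le_rfl hmd.le⟩, d, hmd,
      ⟨hd, hhalt, hnoop _ hmd.le le_rfl, hpop⟩, fun k h1 h2 => ⟨by omega, hnoop k h1.le h2.le⟩⟩,
      fun k h1 h2 => ⟨by omega, hblank k h1.le h2, hpush k (by omega) h2⟩⟩,
      fun k h1 h2 => ⟨by omega, ?_, hpush k h1 (by omega)⟩⟩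
    · rw [hop 0 w.len_pos]
      rfl
    · have hkl : k < l.length := (List.getElem?_eq_some_iff.1 hk).1
      refine ⟨by omega, ?_, hpush _ (by omega) (by omega)⟩
      rw [hinit _ (by omega) (by omega), if_neg (by omega), add_tsub_cancel_left,
        List.getD_eq_getElem?_getD, hk, Option.getD_some]
    · rw [hinit k h1 (by omega), if_pos h2]

theorem models_strictTimes :
    w.Models (MTL.strictTimes) 0 ↔ ∀ i, i + 1 < w.len → w.timeAt i < w.timeAt (i + 1) := by
  simp only [MTL.strictTimes, models_globally, models_neg, models_til, models_tt,
    TimeInterval.mem_singleton, Nat.cast_zero, sub_eq_zero]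
  constructor
  · rintro ⟨-, h⟩ i hi
    refine lt_of_le_of_ne (w.timeAt_mono (Nat.le_succ i) hi) fun he => ?_
    exact (h i (Nat.zero_le _) (by omega)).2 ⟨i + 1, by omega, hi, he.symm, fun k _ _ => by omega⟩
  · intro h
    refine ⟨w.len_pos, fun i _ hi => ⟨hi, ?_⟩⟩
    rintro ⟨j, hij, hj, he, -⟩
    have h1 := h i (by omega)
    have h2 := w.timeAt_mono (show i + 1 ≤ j from hij) hj
    linarith

theorem models_dynamics [Fintype Γ] [Fintype Q] :
    w.Models (MTL.dynamics cell op M) 0 ↔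
      (∃ j, 0 < j ∧ j < w.len ∧ cell (w.letterAt j) = none ∧ op (w.letterAt j) = .noop ∧
        w.timeAt j = w.timeAt 0 + 1) ∧
      (∀ i, i + 1 < w.len → w.timeAt i < w.timeAt (i + 1)) ∧
      ∀ i, (∃ j, i + 1 < j ∧ j < w.len ∧ IsHaltingCell M (cell (w.letterAt j)) ∧
          op (w.letterAt j) = .noop) →
        ∃ j, i + 1 < j ∧ j < w.len ∧ w.timeAt j = w.timeAt (i + 1) + 1 ∧
          cell (w.letterAt j) = localRule M (cell (w.letterAt i)) (cell (w.letterAt (i + 1)))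
            (cell (w.letterAt (i + 2))) := by
  simp only [MTL.dynamics, MTL.copyWindow, MTL.separator, MTL.haltingLetter, models_conj,
    models_afterOne, models_isLetter, models_strictTimes, models_bigConj,
    List.forall_mem_map, Finset.mem_toList, Finset.mem_univ, forall_true_left, Prod.forall,
    models_globally, models_neg, models_next, models_letterIn, models_eventually]
  refine and_congr ?_ (and_congr_right fun _ => ?_)
  · exact ⟨fun ⟨j, h0, ⟨hj, hc, ho⟩, ht⟩ => ⟨j, h0, hj, hc, ho, ht⟩,
      fun ⟨j, h0, hj, hc, ho, ht⟩ => ⟨j, h0, ⟨hj, hc, ho⟩, ht⟩⟩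
  · constructor
    · rintro ⟨-, h⟩ i ⟨k, hik, hk, hh, ho⟩
      by_contra hc
      refine ((h _ _ _).2 i (Nat.zero_le _) (by omega)).2 ⟨⟨by omega, rfl⟩, ⟨by omega, rfl⟩,
        ⟨by omega, rfl⟩, ⟨k, hik, hk, hh, ho⟩, by omega, ?_⟩
      rintro ⟨j, hij, ⟨hj, he⟩, ht⟩
      exact hc ⟨j, hij, hj, ht, he⟩
    · intro h
      refine ⟨w.len_pos, fun a b c => ⟨w.len_pos, fun i _ hi => ⟨hi, ?_⟩⟩⟩
      rintro ⟨⟨-, ha⟩, ⟨-, hb⟩, ⟨-, hc⟩, ⟨k, hik, hk, hh, ho⟩, -, hn⟩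
      obtain ⟨j, hij, hj, ht, he⟩ := h i ⟨k, hik, hk, hh, ho⟩
      exact hn ⟨j, hij, ⟨hj, by rw [he, ← ha, ← hb, ← hc]⟩, ht⟩

/-- A strictly increasing sequence of `d` numbers in an interval of at most `d` integers leaves no
gap. This is where inserted letters are ruled out. -/
theorem eq_add_of_strictMono {f : ℕ → ℕ} {m d N : ℕ} (hf : ∀ n, n + 1 < d → f n < f (n + 1))
    (h0 : m ≤ f 0) (hN : ∀ n < d, f n < N) (hd : N ≤ d + m) : ∀ n < d, f n = n + m := by
  have lower : ∀ n < d, n + m ≤ f n := by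
    intro n hn
    induction n with
    | zero => omega
    | succ n ih =>
      have h1 := hf n hn
      have h2 := ih (by omega)
      omega
  have upper : ∀ k n, n + k + 1 = d → f n + k + 1 ≤ N := by
    intro k
    induction k with
    | zero => intro n hn; exact hN n (by omega)
    | succ k ih =>
      intro n hn
      have h1 := hf n (by omega)
      have h2 := ih (n + 1) (by omega)
      omega
  intro n hn
  have h1 := lower n hn
  have h2 := upper (d - 1 - n) n (by omega)
  omega

/-- A word of non-negative total weight that satisfies the specification is a trace. -/
theorem exists_isTrace_of_models [Fintype Γ] [Fintype Q] {l : List (Cell Γ Q)}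
    (h : w.Models (.conj (MTL.shape cell op M l) (MTL.dynamics cell op M)) 0)
    (hw : 0 ≤ ∑ i ∈ Finset.range w.len, (op (w.letterAt i)).effect) :
    ∃ p m d x, IsTrace M l p m d x := by
  rw [models_conj, models_shape, models_dynamics] at h
  obtain ⟨⟨p, m, d, hp, hlm, hmd, hd, hc0, hinit, hcm, hhalt, hop⟩, ⟨s, hs0, hs, hcs, hos, hts⟩,
    hstrict, hcopy⟩ := h
  have hsum : ∑ i ∈ Finset.range w.len, (op (w.letterAt i)).effect =
      ∑ i ∈ Finset.range w.len, (phase m d i).effect :=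
    Finset.sum_congr rfl fun i hi => by rw [hop i (Finset.mem_range.1 hi)]
  rw [hsum, sum_phase (by omega) hmd.le] at hw
  -- The `w.len - 1 - d` pops cannot exceed the `m - 1` pushes.
  have hlen : w.len ≤ d + m := by omega
  have hdm : op (w.letterAt d) = .noop := by
    rw [hop d hd, phase, if_neg (by omega), if_neg (by omega), if_pos le_rfl]
  have hms : m ≤ s := by
    by_contra hc
    rw [hop s hs, phase, if_neg (by omega), if_pos (by omega)] at hos
    cases hos
  -- For `n < d`, a position one time unit after `n`: from the anchor if `n = 0`, and otherwise from
  -- the window with middle `n`.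
  have hex : ∀ n, ∃ j, n < d → j < w.len ∧ w.timeAt j = w.timeAt n + 1 ∧ (n = 0 → m ≤ j) ∧
      (0 < n → cell (w.letterAt j) = localRule M (cell (w.letterAt (n - 1)))
        (cell (w.letterAt n)) (cell (w.letterAt (n + 1)))) := by
    intro n
    rcases n with _ | n
    · exact ⟨s, fun _ => ⟨hs, hts, fun _ => hms, fun h => absurd h (lt_irrefl _)⟩⟩
    · by_cases hn : n + 1 < d
      · obtain ⟨j, -, hj, ht, he⟩ := hcopy n ⟨d, hn, hd, hhalt, hdm⟩
        exact ⟨j, fun _ => ⟨hj, ht, fun h => by omega, fun _ => he⟩⟩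
      · exact ⟨0, fun h => absurd h hn⟩
  choose f hf using hex
  have hfm : ∀ n, n + 1 < d → f n < f (n + 1) := by
    intro n hn
    by_contra hc
    have h1 := hf n (by omega)
    have h2 := hf (n + 1) hn
    have h3 := w.timeAt_mono (not_lt.1 hc) h1.1
    have h4 := hstrict n (by omega)
    linarith [h1.2.1, h2.2.1]
  -- The image of `n` is now known to be `n + m`, so a condition on times has become one on
  -- positions.
  have hfe := eq_add_of_strictMono hfm ((hf 0 (by omega)).2.2.1 rfl) (fun n hn => (hf n hn).1) hlen
  refine ⟨p, m, d, fun n => cell (w.letterAt n), hp, hlm, hmd, hc0, hinit, hcm, fun n h0 hn => ?_,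
    hhalt⟩
  rw [← hfe n hn]
  exact (hf n hn).2.2.2 h0

/-- The timed word of a trace, with rows of duration one, satisfies the specification. -/
theorem models_of_isTrace [Fintype Γ] [Fintype Q] {l : List (Cell Γ Q)} {p m d : ℕ}
    {x : ℕ → Cell Γ Q} (h : IsTrace M l p m d x) (hlen : w.len = d + m)
    (hcell : ∀ i < d + m, cell (w.letterAt i) = x i)
    (hop : ∀ i < d + m, op (w.letterAt i) = phase m d i)
    (htime : ∀ i < d + m, w.timeAt i = i / m) :
    w.Models (.conj (MTL.shape cell op M l) (MTL.dynamics cell op M)) 0 := by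
  obtain ⟨hp, hlm, hmd, hc0, hinit, hcm, hrule, hhalt⟩ := h
  have hm : (0 : ℝ) < m := by exact_mod_cast (by omega : 0 < m)
  have hadd : ∀ i, i + m < d + m → w.timeAt (i + m) = w.timeAt i + 1 := by
    intro i hi
    rw [htime _ hi, htime i (by omega), Nat.cast_add, add_div, div_self hm.ne']
  rw [models_conj, models_shape, models_dynamics]
  refine ⟨⟨p, m, d, hp, hlm, hmd, by omega, ?_, fun j h0 hj => ?_, ?_, ?_, ?_⟩,
    ⟨m, by omega, by omega, ?_, ?_, ?_⟩, fun i hi => ?_, ?_⟩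
  · rw [hcell 0 (by omega), hc0]
  · rw [hcell j (by omega), hinit j h0 hj]
  · rw [hcell m (by omega), hcm]
  · rwa [hcell d (by omega)]
  · rwa [hlen]
  · rw [hcell m (by omega), hcm]
  · rw [hop m (by omega), phase, if_neg (by omega), if_neg (by omega), if_pos hmd.le]
  · simpa using hadd 0 (by omega)
  · rw [htime i (by omega), htime (i + 1) (by omega)]
    exact div_lt_div_of_pos_right (by push_cast; linarith) hm
  · rintro i ⟨k, hik, hk, -, ho⟩
    -- Only pops follow `d`, so `i + 1 < d` and the image at `i + 1 + m` is still in the word.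
    have hkd : k ≤ d := by
      by_contra hc
      rw [hop k (by omega), phase, if_neg (by omega), if_neg (by omega), if_neg hc] at ho
      cases ho
    refine ⟨i + 1 + m, by omega, by omega, hadd _ (by omega), ?_⟩
    rw [hcell _ (by omega), hcell i (by omega), hcell (i + 1) (by omega), hcell (i + 2) (by omega)]
    exact hrule (i + 1) (by omega) (by omega)

end Semantics

/-! ### The universal clockless automaton and its runs. -/

noncomputable section Automaton

variable {S : Type} [Fintype S] (op : S → CounterOp)

/-- The automaton with a single location and without clocks in which every letter can be read
everywhere and causes its own operation. -/
def letterAutomaton : DWTA S (Fin 1) (Fin 0) where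
  initial := [0]
  accepting := [0]
  edges := Finset.univ.toList.map fun s => ⟨0, s, [], op s, [], 0⟩

variable {op}

theorem letterAutomaton_step_iff {q q' : State (Fin 1) (Fin 0)} {d : ℝ≥0} {a : S} :
    (letterAutomaton op).Step q d a q' ↔ q'.weight = q.weight + (op a).effect := by
  simp only [DWTA.Step, letterAutomaton, List.mem_map, Finset.mem_toList, Finset.mem_univ,
    true_and]
  constructor
  · rintro ⟨_, ⟨s, rfl⟩, -, rfl, -, -, -, h⟩
    exact h
  · intro h
    exact ⟨_, ⟨a, rfl⟩, Subsingleton.elim _ _, rfl, Subsingleton.elim _ _,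
      fun p hp => absurd hp List.not_mem_nil, fun x => x.elim0, h⟩

theorem weight_eq_sum (r : (letterAutomaton op).Run) (h0 : (r.state 0).weight = 0) (i : ℕ)
    (hi : i < r.len + 1) :
    (r.state ⟨i, hi⟩).weight = ∑ j ∈ Finset.range i, (op (r.word.letterAt j)).effect := by
  induction i with
  | zero => simpa using h0
  | succ i ih =>
    have hl : i < r.len := by omega
    have h1 := letterAutomaton_step_iff.1 (r.step ⟨i, hl⟩)
    rw [Finset.sum_range_succ, ← ih (by omega), r.word.letterAt_of_lt hl]
    exact h1

/-- The run of the automaton on a sequence of letters and delays. -/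
def letterRun (op : S → CounterOp) (letter : ℕ → S) (delay : ℕ → ℝ≥0) (n : ℕ) (hn : 0 < n) :
    (letterAutomaton op).Run where
  len := n
  len_pos := hn
  state := fun i => ⟨0, fun _ => 0, ∑ j ∈ Finset.range i, (op (letter j)).effect⟩
  delay := fun i => delay i
  letter := fun i => letter i
  step := fun i => letterAutomaton_step_iff.2 (by simp [Finset.sum_range_succ])

theorem letterRun_accepting (letter : ℕ → S) (delay : ℕ → ℝ≥0) (n : ℕ) (hn : 0 < n) :
    (letterRun op letter delay n hn).Accepting := by
  refine ⟨?_, fun x => x.elim0, ?_, ?_⟩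
  · simp [letterRun, letterAutomaton]
  · simp [letterRun]
  · simp [letterRun, letterAutomaton]

theorem letterAt_letterRun (letter : ℕ → S) (delay : ℕ → ℝ≥0) (n : ℕ) (hn : 0 < n) {i : ℕ}
    (hi : i < n) : (letterRun op letter delay n hn).word.letterAt i = letter i :=
  TimedWord.letterAt_of_lt _ hi

theorem timeAt_letterRun (letter : ℕ → S) (delay : ℕ → ℝ≥0) (n : ℕ) (hn : 0 < n) {i : ℕ}
    (hi : i < n) : (letterRun op letter delay n hn).word.timeAt i =
      ((∑ j ∈ Finset.range (i + 1), delay j : ℝ≥0) : ℝ) := by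
  refine (TimedWord.timeAt_of_lt _ hi).trans (congrArg NNReal.toReal ?_)
  change ∑ j ∈ Finset.Iic (⟨i, hi⟩ : Fin n), delay j = _
  refine (Finset.sum_map (Finset.Iic (⟨i, hi⟩ : Fin n)) Fin.valEmbedding delay).symm.trans ?_
  rw [Fin.map_valEmbedding_Iic, Nat.range_succ_eq_Iic]

end Automaton

/-! ### The reduction, its computability, and undecidability. -/

noncomputable section Reduction

set_option linter.unusedSectionVars false

open Turing

variable {Γ Q S : Type} [Inhabited Γ] [Inhabited Q] [Fintype S] {cell : S → Cell Γ Q}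
  {op : S → CounterOp} {M : TM0.Machine Γ Q} [Fintype Γ] [Fintype Q]

theorem energyHolds_iff (mk : Cell Γ Q → CounterOp → S) (hcell : ∀ c o, cell (mk c o) = c)
    (hop : ∀ c o, op (mk c o) = o) {l : List Γ} (hl : l ≠ []) :
    EnergyHolds (letterAutomaton op)
      (.conj (MTL.shape cell op M (inputCells l)) (MTL.dynamics cell op M)) ↔
        (TM0.eval M l).Dom := by
  constructor
  · rintro ⟨r, ⟨-, -, h0, -⟩, hw, hf⟩
    -- Only the final weight matters in this direction, as pops occur only at the end.
    have hlast := hw (Fin.last r.len)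
    rw [Fin.last, weight_eq_sum r h0] at hlast
    obtain ⟨p, m, d, x, hx⟩ := exists_isTrace_of_models (TimedWord.satisfies_iff.1 hf) hlast
    exact hx.eval_dom hl
  · intro h
    obtain ⟨p, m, d, x, hx⟩ := exists_isTrace M hl h
    have hmd := hx.lt_halt
    have hm : 0 < m := by have := hx.lt; omega
    have hn : 0 < d + m := by omega
    -- The first letter has time `0` and the `i`-th has time `i / m`, so one row lasts one time
    -- unit.
    let delay : ℕ → ℝ≥0 := fun i => if i = 0 then 0 else 1 / m
    let letter : ℕ → S := fun i => mk (x i) (phase m d i)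
    refine ⟨letterRun op letter delay (d + m) hn, letterRun_accepting _ _ _ _, fun i => ?_, ?_⟩
    · have hi : (i : ℕ) < d + m + 1 := i.2
      change 0 ≤ ∑ j ∈ Finset.range i, (op (letter j)).effect
      simp only [letter, hop]
      rw [sum_phase hm hmd.le]
      omega
    · refine TimedWord.satisfies_iff.2 (models_of_isTrace hx rfl ?_ ?_ ?_)
      · intro i hi
        rw [letterAt_letterRun _ _ _ _ hi, hcell]
      · intro i hi
        rw [letterAt_letterRun _ _ _ _ hi, hop]
      · intro i hi
        rw [timeAt_letterRun _ _ _ _ hi, Finset.sum_range_succ']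
        simp [delay, div_eq_mul_inv]

open Classical in
instance : Fintype CounterOp :=
  ⟨{CounterOp.push, CounterOp.pop, CounterOp.noop}, fun x => by cases x <;> simp⟩

variable (M) in
def letterEquiv : Cell Γ Q × CounterOp ≃ Fin (Fintype.card (Cell Γ Q × CounterOp)) :=
  Fintype.equivFin _

variable (M) in
/-- The instance of the model checking problem that simulates the machine `M` on the input `l`. -/
def simulation (l : List Γ) : Problem where
  numSymbols := Fintype.card (Cell Γ Q × CounterOp)
  numLocs := 1
  numClocks := 0
  automaton := letterAutomaton fun s => (letterEquiv.symm s : Cell Γ Q × CounterOp).2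
  formula := .conj
    (MTL.shape (fun s => (letterEquiv.symm s).1) (fun s => (letterEquiv.symm s).2) M (inputCells l))
    (MTL.dynamics (fun s => (letterEquiv.symm s).1) (fun s => (letterEquiv.symm s).2) M)

theorem simulation_positive_iff {l : List Γ} (hl : l ≠ []) :
    (simulation M l).Positive ↔ (TM0.eval M l).Dom :=
  energyHolds_iff (fun c o => letterEquiv (c, o)) (by simp) (by simp) hl

theorem primrec_code_conj {k : ℕ} {F G : ℕ → MTL (Fin k)} (hF : Primrec fun n => (F n).code)
    (hG : Primrec fun n => (G n).code) : Primrec fun n => ((F n).conj (G n)).code :=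
  Primrec₂.natPair.comp (Primrec.const 3) (Primrec₂.natPair.comp hF hG)

theorem primrec_code_untl {k : ℕ} {F G : ℕ → MTL (Fin k)} (hF : Primrec fun n => (F n).code)
    (hG : Primrec fun n => (G n).code) : Primrec fun n => ((F n).untl (G n)).code :=
  Primrec₂.natPair.comp (Primrec.const 4)
    (Primrec₂.natPair.comp (Primrec.const _) (Primrec₂.natPair.comp hF hG))

theorem primrec_code_next {k : ℕ} {F : ℕ → MTL (Fin k)} (hF : Primrec fun n => (F n).code) :
    Primrec fun n => (F n).next.code :=
  primrec_code_untl (Primrec.const _) hF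

/-- Each further `a` wraps the code of the remaining formula by the same arithmetic function, so the
code arises by iterating that function `n` times. -/
theorem primrec_code_listed_replicate {k : ℕ} (cell : Fin k → Cell Γ Q) (op : Fin k → CounterOp)
    (g : MTL (Fin k)) (a : Cell Γ Q) :
    Primrec fun n => (MTL.listed cell op g (List.replicate n a)).code := by
  have step : Primrec fun y => (3).pair ((MTL.isLetter cell op a .push).code.pair
      ((4).pair (TimeInterval.unbounded.code.pair ((MTL.neg .tt : MTL (Fin k)).code.pair y)))) :=
    Primrec₂.natPair.comp (Primrec.const _) <| Primrec₂.natPair.comp (Primrec.const _) <|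
      Primrec₂.natPair.comp (Primrec.const _) <| Primrec₂.natPair.comp (Primrec.const _) <|
      Primrec₂.natPair.comp (Primrec.const _) Primrec.id
  refine (Primrec.nat_iterate Primrec.id (Primrec.const g.code) (step.comp₂ .right)).of_eq
    fun n => ?_
  induction n with
  | zero => rfl
  | succ n ih =>
    simp only [id_eq] at ih ⊢
    rw [Function.iterate_succ_apply', ih]
    rfl

theorem primrec_code_formula {k : ℕ} (cell : Fin k → Cell Γ Q) (op : Fin k → CounterOp)
    (u v b : Γ) : Primrec fun n : ℕ =>
      (MTL.conj (MTL.shape cell op M (inputCells (u :: v :: List.replicate n b)))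
        (MTL.dynamics cell op M)).code := by
  refine primrec_code_conj (primrec_code_conj (Primrec.const _) (primrec_code_untl (Primrec.const _)
    ?_)) (Primrec.const _)
  simp only [inputCells, List.map_cons, List.map_replicate, MTL.listed]
  exact primrec_code_conj (Primrec.const _) (primrec_code_next
    (primrec_code_conj (Primrec.const _) (primrec_code_next
      (primrec_code_listed_replicate cell op _ _))))

theorem computable_encoding {k m c : ℕ} (A : DWTA (Fin k) (Fin m) (Fin c)) {F : ℕ → MTL (Fin k)}
    (hF : Primrec fun n => (F n).code) : Computable fun n => encoding ⟨k, m, c, A, F n⟩ :=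
  ((Primrec.const k).pair ((Primrec.const m).pair ((Primrec.const c).pair
    ((Primrec.const (A.initial.map Fin.val)).pair ((Primrec.const (A.accepting.map Fin.val)).pair
      ((Primrec.const (A.edges.map Edge.code)).pair hF)))))).to_comp

theorem computable_encoding_simulation (u v b : Γ) :
    Computable fun n : ℕ => encoding (simulation M (u :: v :: List.replicate n b)) :=
  computable_encoding _ (primrec_code_formula _ _ u v b)

/-- Every simulating instance is clockless, so a decision procedure for any class containing the
clockless instances would decide halting of the fixed machine. -/
theorem not_decidableOn {C : Problem → Prop} (hC : ∀ P : Problem, P.numClocks = 0 → C P) :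
    ¬ DecidableOn encoding C Problem.Positive := by
  rintro ⟨f, hf, h⟩
  obtain ⟨Γ, Q, _, _, _, _, M, u, v, b, hM⟩ := exists_undecidable_machine
  refine hM (ComputablePred.computable_iff.2
    ⟨_, hf.comp (computable_encoding_simulation (M := M) u v b), funext fun n => ?_⟩)
  rw [eq_iff_iff, h _ (hC _ rfl)]
  exact (simulation_positive_iff (List.cons_ne_nil _ _)).symm

end Reduction

end DWTAEnergy

theorem mainTheorem6 :
    ¬ DWTAEnergy.DecidableOn DWTAEnergy.encoding (fun _ => True) DWTAEnergy.Problem.Positive ∧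
      ¬ DWTAEnergy.DecidableOn DWTAEnergy.encoding (fun P => P.numClocks = 0)
        DWTAEnergy.Problem.Positive :=
  ⟨DWTAEnergy.not_decidableOn fun _ _ => trivial, DWTAEnergy.not_decidableOn fun _ h => h⟩
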